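/- **Definitions.** An arithmetic circuit over $\mathbb{R}$ is a finite acyclic directed graph (parallel edges allowed) with a designated output node. Its nodes of indegree $0$ are exactly its input nodes, each labelled by a variable or a real constant. Every other node is either an addition node, which computes the weighted sum of its inputs with arbitrary (possibly negative) real weights on the incoming edges, or a multiplication node, which computes the unweighted product of its inputs. Its size is its number of nodes plus its number of edges. Let $p:\{0,1\}^n\to[0,1]$ be the joint probability mass function of $n$ binary random variables $X_1,\dots,X_n$. A *probabilistic generating circuit* (PGC) for $p$ is an arithmetic circuit in variables $z_1,\dots,z_n$ that computes the probability generating polynomial $$\sum_{a\in\{0,1\}^n} p(a)\, z_1^{a_1}\cdots z_n^{a_n}.$$ A *nonmonotone probabilistic circuit* (nonmonotone PC) over $n$ binary variables is an arithmetic circuit whose input nodes are all labelled by variables among $x_1,\bar x_1,\dots,x_n,\bar x_n$ (no constant inputs). It *computes the probability mass function $p$* if, for every $a\in\{0,1\}^n$, its output polynomial takes the value $p(a)$ at $x_i=a_i$, $\bar x_i=1-a_i$ ($1\le i\le n$). A polynomial in $x_1,\bar x_1,\dots,x_n,\bar x_n$ is *set-multilinear* with respect to the partition $\{x_i,\bar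 x_i\}$, $1\le i\le n$, if each of its monomials contains, for every $i$, exactly one of $x_i,\bar x_i$, and that one with degree $1$. **Theorem.** PGCs over binary variables can be simulated by nonmonotone PCs with only polynomial overhead in size. That is, there are absolute constants $c,k\in\mathbb{N}$ such that for every $n\ge 1$, every probability mass function $p$ on $\{0,1\}^n$ and every PGC of size $s$ for $p$, there is a nonmonotone PC of size at most $c\,(s+n)^k$ that computes the probability mass function $p$ and whose output polynomial is set-multilinear with respect to the partition $\{x_i,\bar x_i\}$, $1\le i\le n$. -/

import Mathlib

/-! Arithmetic circuits over the reals, probabilistic generating circuits (PGCs) and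
nonmonotone probabilistic circuits (PCs). -/

/-- Label of a node of an arithmetic circuit with variables `σ` and node set `V`: an input
(a variable or a real constant), a weighted sum of its children (with the weights of the incoming
edges; they may be negative), or an unweighted product of its children.
Parallel edges are allowed, so children are given as lists. -/
inductive Gate (σ V : Type) : Type where
  | var (x : σ) : Gate σ V
  | const (c : ℝ) : Gate σ V
  | add (es : List (ℝ × V)) : Gate σ V
  | mul (es : List V) : Gate σ V

/-- The children of a node, one entry for every incoming edge. -/
def Gate.children {σ V : Type} : Gate σ V → List V
  | .var _ => []
  | .const _ => []
  | .add es => es.map Prod.snd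
  | .mul es => es

/-- An arithmetic circuit: a finite acyclic directed graph whose nodes of indegree `0` are exactly
the input nodes, with a designated output node. -/
structure ArithCircuit (σ : Type) where
  Node : Type
  fintypeNode : Fintype Node
  gate : Node → Gate σ Node
  add_ne_nil : ∀ v es, gate v = Gate.add es → es ≠ []
  mul_ne_nil : ∀ v es, gate v = Gate.mul es → es ≠ []
  acyclic : ∀ v, ¬ Relation.TransGen (fun u w => u ∈ (gate w).children) v v
  output : Node

attribute [instance] ArithCircuit.fintypeNode

namespace ArithCircuit

variable {σ : Type}

/-- `C.Edge u v`: there is an edge from `u` into `v`. -/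
def Edge (C : ArithCircuit σ) (u v : C.Node) : Prop := u ∈ (C.gate v).children

theorem wf (C : ArithCircuit σ) : WellFounded C.Edge := by
  have h : WellFounded (Relation.TransGen C.Edge) :=
    haveI : Std.Irrefl (Relation.TransGen C.Edge) := ⟨C.acyclic⟩
    Finite.wellFounded_of_trans_of_irrefl _
  exact Subrelation.wf (fun h => Relation.TransGen.single h) h

/-- The size of a circuit: its number of nodes plus its number of edges (with multiplicity). -/
def size (C : ArithCircuit σ) : ℕ := Fintype.card C.Node + ∑ v, (C.gate v).children.length

/-- The polynomial computed at a node whose label is `g`, given those computed at its children. -/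
noncomputable def gatePoly {V : Type} (g : Gate σ V)
    (ih : ∀ u, u ∈ g.children → MvPolynomial σ ℝ) : MvPolynomial σ ℝ :=
  match g, ih with
  | .var x, _ => MvPolynomial.X x
  | .const c, _ => MvPolynomial.C c
  | .add es, ih => (es.attach.map fun e =>
      MvPolynomial.C e.1.1 * ih e.1.2 (List.mem_map_of_mem (f := Prod.snd) e.2)).sum
  | .mul es, ih => (es.attach.map fun e => ih e.1 e.2).prod

/-- The polynomial computed at a node of a circuit. -/
noncomputable def nodePoly (C : ArithCircuit σ) : C.Node → MvPolynomial σ ℝ :=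
  C.wf.fix fun v ih => gatePoly (C.gate v) ih

/-- The polynomial computed by a circuit. -/
noncomputable def poly (C : ArithCircuit σ) : MvPolynomial σ ℝ := C.nodePoly C.output

/-- The polynomials computed at the nodes satisfy the expected recursion. -/
theorem nodePoly_eq (C : ArithCircuit σ) (v : C.Node) :
    C.nodePoly v = match C.gate v with
      | .var x => MvPolynomial.X x
      | .const c => MvPolynomial.C c
      | .add es => (es.map fun e => MvPolynomial.C e.1 * C.nodePoly e.2).sum
      | .mul es => (es.map fun e => C.nodePoly e).prod := by
  have key : ∀ g : Gate σ C.Node, gatePoly g (fun u _ => C.nodePoly u) = match g with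
      | .var x => MvPolynomial.X x
      | .const c => MvPolynomial.C c
      | .add es => (es.map fun e => MvPolynomial.C e.1 * C.nodePoly e.2).sum
      | .mul es => (es.map fun e => C.nodePoly e).prod := by
    intro g
    cases g with
    | var x => rfl
    | const c => rfl
    | add es =>
      exact congrArg List.sum
        (List.attach_map_val (l := es) (f := fun e => MvPolynomial.C e.1 * C.nodePoly e.2))
    | mul es =>
      exact congrArg List.prod (List.attach_map_val (l := es) (f := fun e => C.nodePoly e))
  rw [← key]
  exact C.wf.fix_eq (fun v ih => gatePoly (C.gate v) ih) v

end ArithCircuit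

/-- The probability generating function
`∑ p(j₁, …, jₙ) z₁ ^ j₁ ⋯ zₙ ^ jₙ` of a joint distribution `p` of `n` categorial random variables
with image `{0, …, d-1}`. -/
noncomputable def genPoly {n d : ℕ} (p : PMF (Fin n → Fin d)) : MvPolynomial (Fin n) ℝ :=
  ∑ j : Fin n → Fin d, MvPolynomial.C (p j).toReal * ∏ i, MvPolynomial.X i ^ (j i : ℕ)

/-- `C` is a probabilistic generating circuit for the distribution `p`. -/
def IsPGC {n d : ℕ} (C : ArithCircuit (Fin n)) (p : PMF (Fin n → Fin d)) : Prop :=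
  C.poly = genPoly p

/-- A nonmonotone PC over `n` categorial random variables with image `{0, …, d-1}`: an arithmetic
circuit, with arbitrary real edge weights, whose inputs are labelled by the variables `z_{i,j}`
only, the variable `z_{i,j}` being represented by the pair `(i, j)`. For binary random variables,
`(i, 1)` is `x_i` and `(i, 0)` is `x̄_i`. -/
def IsNonmonotonePC {n d : ℕ} (C : ArithCircuit (Fin n × Fin d)) : Prop :=
  ∀ (v : C.Node) (c : ℝ), C.gate v ≠ Gate.const c

/-- The input that represents the elementary event `X₁ = a₁, …, Xₙ = aₙ`: the variable `z_{i,j}`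
is set to `1` if `j = a_i`, and to `0` otherwise. -/
def eventPoint {n d : ℕ} (a : Fin n → Fin d) : Fin n × Fin d → ℝ :=
  fun x => if x.2 = a x.1 then 1 else 0

/-- `C` computes the probability mass function `p`: the value of `C` on an elementary event is the
probability of this event. -/
def ComputesPMF {n d : ℕ} (C : ArithCircuit (Fin n × Fin d)) (p : PMF (Fin n → Fin d)) : Prop :=
  ∀ a : Fin n → Fin d, MvPolynomial.eval (eventPoint a) C.poly = (p a).toReal

/-- `P` is set-multilinear with respect to the parts `Y`: every monomial of `P` contains exactly
one variable from each part, with degree `1`. -/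
def IsSetMultilinear {σ ι : Type} (Y : ι → Set σ) (P : MvPolynomial σ ℝ) : Prop :=
  ∀ m ∈ P.support, ∀ i, ∃ x ∈ Y i, m x = 1 ∧ ∀ y ∈ Y i, y ≠ x → m y = 0

/-- The parts `{z_{i,0}, …, z_{i,d-1}}` of the variables of a PC. -/
def variableParts (n d : ℕ) : Fin n → Set (Fin n × Fin d) := fun i => {x | x.1 = i}

open MvPolynomial

/-! Substitute `z_i = T x_i / (1 + T x̄_i)` into the generating polynomial and multiply by `∏ (1 + T
x̄_i)`. The monomial of `a` becomes a product of `n` factors linear in `T`: `T x_i` where `a_i = 1`,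
and `1 + T x̄_i` where `a_i = 0`. Its coefficient of `T ^ n` is the event monomial of `a`, so `T ^
n` carries the required set-multilinear polynomial (`coeff_seriesSubst_genPoly`).

No division is needed: the quotients are geometric series in `T`, and truncated series suffice, so
each edge of the given circuit costs `O(n ^ 2)` operations (`Holds.circuit`). Constant inputs
disappear as well: every series that occurs has a real number as its constant coefficient. That
number is never stored but enters only as an edge weight, also in products (`Holds.mul`). -/

/-- The value of a gate when its children carry the values `f`. -/
noncomputable def Gate.value {σ V : Type} (f : V → MvPolynomial σ ℝ) : Gate σ V → MvPolynomial σ ℝ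
  | .var x => X x
  | .const c => C c
  | .add es => (es.map fun e => C e.1 * f e.2).sum
  | .mul es => (es.map f).prod

theorem ArithCircuit.nodePoly_eq_value {σ : Type} (D : ArithCircuit σ) (v : D.Node) :
    D.nodePoly v = (D.gate v).value D.nodePoly := by
  rw [D.nodePoly_eq v]
  cases D.gate v <;> rfl

theorem Gate.value_congr {σ V : Type} {f g : V → MvPolynomial σ ℝ} (G : Gate σ V)
    (h : ∀ u ∈ G.children, f u = g u) : G.value f = G.value g := by
  cases G with
  | var x => rfl
  | const c => rfl
  | add es =>
    simp only [Gate.value]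
    congr 1
    refine List.map_congr_left fun e he => ?_
    rw [h e.2 (List.mem_map_of_mem he)]
  | mul es =>
    simp only [Gate.value]
    congr 1
    exact List.map_congr_left h

/-! ### Straight-line programs without constants -/

/-- A straight-line program without constants: the list of its results, the most recent first. -/
inductive IsProgram {σ : Type} : List (MvPolynomial σ ℝ) → Prop
  | nil : IsProgram []
  | var (x : σ) {L} (hL : IsProgram L) : IsProgram (X x :: L)
  | lin (a b : ℝ) {P Q} {L} (hL : IsProgram L) (hP : P ∈ L) (hQ : Q ∈ L) :
      IsProgram ((C a * P + C b * Q) :: L)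
  | mul {P Q} {L} (hL : IsProgram L) (hP : P ∈ L) (hQ : Q ∈ L) : IsProgram (P * Q :: L)

namespace IsProgram

variable {σ : Type}

/-- The newest result comes first, so operands have strictly larger indices; this order makes the
resulting graph acyclic. -/
theorem get_cases {L : List (MvPolynomial σ ℝ)} (h : IsProgram L) (i : Fin L.length) :
    (∃ x, L.get i = X x) ∨
    (∃ j k : Fin L.length, i < j ∧ i < k ∧ ∃ a b : ℝ,
      L.get i = C a * L.get j + C b * L.get k) ∨
    (∃ j k : Fin L.length, i < j ∧ i < k ∧ L.get i = L.get j * L.get k) := by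
  induction h with
  | nil => exact i.elim0
  | var x hL ih =>
    refine Fin.cases ?_ (fun i => ?_) i
    · exact Or.inl ⟨x, rfl⟩
    · rcases ih i with ⟨x, h⟩ | ⟨j, k, hj, hk, a, b, h⟩ | ⟨j, k, hj, hk, h⟩
      · exact Or.inl ⟨x, h⟩
      · exact Or.inr (Or.inl ⟨j.succ, k.succ, Fin.succ_lt_succ_iff.2 hj,
          Fin.succ_lt_succ_iff.2 hk, a, b, h⟩)
      · exact Or.inr (Or.inr ⟨j.succ, k.succ, Fin.succ_lt_succ_iff.2 hj,
          Fin.succ_lt_succ_iff.2 hk, h⟩)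
  | lin a b hL hP hQ ih =>
    refine Fin.cases ?_ (fun i => ?_) i
    · obtain ⟨j, rfl⟩ := List.mem_iff_get.1 hP
      obtain ⟨k, rfl⟩ := List.mem_iff_get.1 hQ
      exact Or.inr (Or.inl ⟨j.succ, k.succ, Fin.succ_pos _, Fin.succ_pos _, a, b, rfl⟩)
    · rcases ih i with ⟨x, h⟩ | ⟨j, k, hj, hk, a, b, h⟩ | ⟨j, k, hj, hk, h⟩
      · exact Or.inl ⟨x, h⟩
      · exact Or.inr (Or.inl ⟨j.succ, k.succ, Fin.succ_lt_succ_iff.2 hj,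
          Fin.succ_lt_succ_iff.2 hk, a, b, h⟩)
      · exact Or.inr (Or.inr ⟨j.succ, k.succ, Fin.succ_lt_succ_iff.2 hj,
          Fin.succ_lt_succ_iff.2 hk, h⟩)
  | mul hL hP hQ ih =>
    refine Fin.cases ?_ (fun i => ?_) i
    · obtain ⟨j, rfl⟩ := List.mem_iff_get.1 hP
      obtain ⟨k, rfl⟩ := List.mem_iff_get.1 hQ
      exact Or.inr (Or.inr ⟨j.succ, k.succ, Fin.succ_pos _, Fin.succ_pos _, rfl⟩)
    · rcases ih i with ⟨x, h⟩ | ⟨j, k, hj, hk, a, b, h⟩ | ⟨j, k, hj, hk, h⟩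
      · exact Or.inl ⟨x, h⟩
      · exact Or.inr (Or.inl ⟨j.succ, k.succ, Fin.succ_lt_succ_iff.2 hj,
          Fin.succ_lt_succ_iff.2 hk, a, b, h⟩)
      · exact Or.inr (Or.inr ⟨j.succ, k.succ, Fin.succ_lt_succ_iff.2 hj,
          Fin.succ_lt_succ_iff.2 hk, h⟩)

theorem exists_gate {L : List (MvPolynomial σ ℝ)} (h : IsProgram L) (i : Fin L.length) :
    ∃ g : Gate σ (Fin L.length), (∀ u ∈ g.children, i < u) ∧ g.children.length ≤ 2 ∧
      (∀ c, g ≠ .const c) ∧ g ≠ .add [] ∧ g ≠ .mul [] ∧ g.value L.get = L.get i := by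
  rcases h.get_cases i with ⟨x, h⟩ | ⟨j, k, hj, hk, a, b, h⟩ | ⟨j, k, hj, hk, h⟩
  · exact ⟨.var x, by simp [Gate.children], by simp [Gate.children], by simp, by simp, by simp,
      h.symm⟩
  · exact ⟨.add [(a, j), (b, k)], by simp [Gate.children, hj, hk], by simp [Gate.children],
      by simp, by simp, by simp, by rw [h]; simp [Gate.value]⟩
  · exact ⟨.mul [j, k], by simp [Gate.children, hj, hk], by simp [Gate.children],
      by simp, by simp, by simp, by rw [h]; simp [Gate.value]⟩

/-- Every result of a constant-free program is computed by a constant-free circuit. -/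
theorem exists_circuit {L : List (MvPolynomial σ ℝ)} (h : IsProgram L)
    {P : MvPolynomial σ ℝ} (hP : P ∈ L) :
    ∃ D : ArithCircuit σ, (∀ v c, D.gate v ≠ Gate.const c) ∧ D.poly = P ∧
      D.size ≤ 3 * L.length := by
  choose g hlt hlen hconst hadd hmul hval using h.exists_gate
  obtain ⟨o, rfl⟩ := List.mem_iff_get.1 hP
  let D : ArithCircuit σ :=
    { Node := Fin L.length
      fintypeNode := inferInstance
      gate := g
      add_ne_nil := fun v es hv he => hadd v (by rw [hv, he])
      mul_ne_nil := fun v es hv he => hmul v (by rw [hv, he])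
      acyclic := by
        have key : ∀ v w, Relation.TransGen (fun u w => u ∈ (g w).children) v w → w < v := by
          intro v w hvw
          induction hvw with
          | single h => exact hlt _ _ h
          | tail _ h ih => exact (hlt _ _ h).trans ih
        exact fun v hv => lt_irrefl _ (key v v hv)
      output := o }
  refine ⟨D, hconst, ?_, ?_⟩
  · have key : ∀ v : D.Node, D.nodePoly v = L.get v := by
      intro v
      induction v using D.wf.induction with
      | _ v ih =>
        rw [D.nodePoly_eq_value, ← hval v]
        exact Gate.value_congr _ ih
    exact key o
  -- One node and at most two incoming edges per instruction give the factor 3.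
  · have h1 : ∑ v : Fin L.length, (g v).children.length ≤ ∑ _v : Fin L.length, 2 :=
      Finset.sum_le_sum fun v _ => hlen v
    have h2 : D.size = Fintype.card (Fin L.length) + ∑ v : Fin L.length, (g v).children.length :=
      rfl
    rw [h2]
    simp only [Finset.sum_const, Finset.card_univ, Fintype.card_fin, smul_eq_mul] at h1 ⊢
    omega

end IsProgram

/-! ### Counting further instructions -/

/-- `L` extends to a program satisfying `T` by at most `c` further instructions. -/
def Extends {σ : Type} (L : List (MvPolynomial σ ℝ)) (c : ℕ)
    (T : List (MvPolynomial σ ℝ) → Prop) : Prop :=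
  ∃ L', L ⊆ L' ∧ IsProgram L' ∧ L'.length ≤ L.length + c ∧ T L'

namespace Extends

variable {σ : Type} {L : List (MvPolynomial σ ℝ)}

theorem refl {T : List (MvPolynomial σ ℝ) → Prop} (hL : IsProgram L) (hT : T L) :
    Extends L 0 T :=
  ⟨L, List.Subset.refl L, hL, le_rfl, hT⟩

theorem bind {c d : ℕ} {T U : List (MvPolynomial σ ℝ) → Prop} (h : Extends L c T)
    (hU : ∀ L', L ⊆ L' → IsProgram L' → T L' → Extends L' d U) : Extends L (c + d) U := by
  obtain ⟨L₁, hs₁, hp₁, hl₁, ht₁⟩ := h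
  obtain ⟨L₂, hs₂, hp₂, hl₂, ht₂⟩ := hU L₁ hs₁ hp₁ ht₁
  exact ⟨L₂, List.Subset.trans hs₁ hs₂, hp₂, by omega, ht₂⟩

theorem mono {c d : ℕ} {T U : List (MvPolynomial σ ℝ) → Prop} (h : Extends L c T) (hcd : c ≤ d)
    (hU : ∀ L', L ⊆ L' → T L' → U L') : Extends L d U := by
  obtain ⟨L₁, hs₁, hp₁, hl₁, ht₁⟩ := h
  exact ⟨L₁, hs₁, hp₁, by omega, hU _ hs₁ ht₁⟩

theorem var (hL : IsProgram L) (x : σ) : Extends L 1 (X x ∈ ·) :=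
  ⟨_, List.subset_cons_self _ _, hL.var x, by simp, by simp⟩

theorem lin (hL : IsProgram L) (a b : ℝ) {P Q : MvPolynomial σ ℝ} (hP : P ∈ L) (hQ : Q ∈ L) :
    Extends L 1 (C a * P + C b * Q ∈ ·) :=
  ⟨_, List.subset_cons_self _ _, hL.lin a b hP hQ, by simp, by simp⟩

theorem mul (hL : IsProgram L) {P Q : MvPolynomial σ ℝ} (hP : P ∈ L) (hQ : Q ∈ L) :
    Extends L 1 (P * Q ∈ ·) :=
  ⟨_, List.subset_cons_self _ _, hL.mul hP hQ, by simp, by simp⟩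

/-- Finitely many targets are reached one after the other. -/
theorem forall_mem {ι : Type} [DecidableEq ι] (hL : IsProgram L) (s : Finset ι) (c : ℕ)
    (T : ι → List (MvPolynomial σ ℝ) → Prop)
    (hT : ∀ i ∈ s, ∀ L₁ L₂, L₁ ⊆ L₂ → T i L₁ → T i L₂)
    (step : ∀ i ∈ s, ∀ L', L ⊆ L' → IsProgram L' → Extends L' c (T i)) :
    Extends L (s.card * c) fun L' => ∀ i ∈ s, T i L' := by
  induction s using Finset.induction_on with
  | empty =>
    exact (refl (T := fun _ => True) hL trivial).mono (Nat.zero_le _) fun _ _ _ => by simp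
  | insert i s hi ih =>
    have h := ih (fun j hj => hT j (Finset.mem_insert_of_mem hj))
      (fun j hj => step j (Finset.mem_insert_of_mem hj))
    rw [Finset.card_insert_of_notMem hi, add_mul, one_mul]
    refine h.bind fun L₁ hs₁ hp₁ ht₁ => ?_
    refine (step i (Finset.mem_insert_self _ _) L₁ hs₁ hp₁).mono le_rfl fun L₂ hs₂ ht₂ => ?_
    intro j hj
    rcases Finset.mem_insert.1 hj with rfl | hj
    · exact ht₂
    · exact hT j (Finset.mem_insert_of_mem hj) _ _ hs₂ (ht₁ j hj)

/-- One multiplication and one addition per term. Starting from `R` avoids the need for an initial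
zero. -/
theorem sum_mul {ι : Type} [DecidableEq ι] (hL : IsProgram L) {R : MvPolynomial σ ℝ} (hR : R ∈ L)
    (s : Finset ι) (P Q : ι → MvPolynomial σ ℝ) (hP : ∀ i ∈ s, P i ∈ L) (hQ : ∀ i ∈ s, Q i ∈ L) :
    Extends L (s.card * 2) (R + ∑ i ∈ s, P i * Q i ∈ ·) := by
  induction s using Finset.induction_on with
  | empty => simpa using refl hL (T := (R ∈ ·)) hR
  | insert i s hi ih =>
    have h := ih (fun j hj => hP j (Finset.mem_insert_of_mem hj))
      (fun j hj => hQ j (Finset.mem_insert_of_mem hj))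
    rw [Finset.card_insert_of_notMem hi, add_mul, one_mul]
    refine h.bind fun L₁ hs₁ hp₁ ht₁ => ?_
    refine ((mul hp₁ (hs₁ (hP i (Finset.mem_insert_self _ _)))
      (hs₁ (hQ i (Finset.mem_insert_self _ _)))).bind (d := 1) fun L₂ hs₂ hp₂ ht₂ =>
        lin hp₂ 1 1 ht₂ (hs₂ ht₁)).mono le_rfl fun L₃ _ h₃ => ?_
    convert h₃ using 1
    rw [Finset.sum_insert hi, map_one]
    ring

end Extends

/-! ### Arithmetic of truncated power series -/

/-- `L` contains the coefficients of degree `1, …, n` of the power series `A`, whose constant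
coefficient is a number. -/
def Holds {σ : Type} (n : ℕ) (A : PowerSeries (MvPolynomial σ ℝ))
    (L : List (MvPolynomial σ ℝ)) : Prop :=
  (∃ a : ℝ, PowerSeries.coeff 0 A = C a) ∧ ∀ d, 1 ≤ d → d ≤ n → PowerSeries.coeff d A ∈ L

namespace Holds

variable {σ : Type} {n : ℕ} {L : List (MvPolynomial σ ℝ)} {A B : PowerSeries (MvPolynomial σ ℝ)}

theorem mono {L' : List (MvPolynomial σ ℝ)} (h : Holds n A L) (hs : L ⊆ L') : Holds n A L' :=
  ⟨h.1, fun d h1 h2 => hs (h.2 d h1 h2)⟩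

theorem const (h0 : (0 : MvPolynomial σ ℝ) ∈ L) (a : ℝ) : Holds n (PowerSeries.C (C a)) L := by
  refine ⟨⟨a, by simp⟩, fun d h1 _ => ?_⟩
  rw [PowerSeries.coeff_C, if_neg (by omega)]
  exact h0

theorem of_coeffs (hL : IsProgram L) (c : ℕ) (ha : ∃ a : ℝ, PowerSeries.coeff 0 A = C a)
    (step : ∀ d, 1 ≤ d → d ≤ n → ∀ L', L ⊆ L' → IsProgram L' →
      Extends L' c (PowerSeries.coeff d A ∈ ·)) : Extends L (n * c) (Holds n A) := by
  have h := Extends.forall_mem hL (Finset.Icc 1 n) c (fun d L' => PowerSeries.coeff d A ∈ L')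
    (fun _ _ _ _ hs h => hs h) (fun d hd => step d (Finset.mem_Icc.1 hd).1 (Finset.mem_Icc.1 hd).2)
  rw [Nat.card_Icc, Nat.add_sub_cancel] at h
  exact h.mono le_rfl fun L' _ hL' => ⟨ha, fun d h1 h2 => hL' d (Finset.mem_Icc.2 ⟨h1, h2⟩)⟩

theorem smul_add (hL : IsProgram L) (a : ℝ) (hA : Holds n A L) (hB : Holds n B L) :
    Extends L n (Holds n (PowerSeries.C (C a) * A + B)) := by
  refine (of_coeffs (n := n) hL 1 ?_ fun d h1 h2 L' hs hp => ?_).mono (by omega) fun _ _ h => h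
  · obtain ⟨x, hx⟩ := hA.1
    obtain ⟨y, hy⟩ := hB.1
    refine ⟨a * x + y, ?_⟩
    rw [map_add, PowerSeries.coeff_C_mul, hx, hy, map_add, map_mul]
  · refine (Extends.lin hp a 1 (hs (hA.2 d h1 h2)) (hs (hB.2 d h1 h2))).mono le_rfl
      fun L₁ _ h => ?_
    convert h using 1
    rw [map_add, PowerSeries.coeff_C_mul, map_one, one_mul]

/-- In the Cauchy product the two extreme terms involve the constant coefficients `a`, `b`, and
together form one linear combination with these as weights. Only the inner terms need genuine
products. -/
theorem mul (hL : IsProgram L) (hA : Holds n A L) (hB : Holds n B L) :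
    Extends L (n * (1 + n * 2)) (Holds n (A * B)) := by
  obtain ⟨a, ha⟩ := hA.1
  obtain ⟨b, hb⟩ := hB.1
  refine of_coeffs hL _ ⟨a * b, ?_⟩ fun d h1 h2 L' hs hp => ?_
  · rw [PowerSeries.coeff_mul, Finset.Nat.antidiagonal_zero, Finset.sum_singleton, ha, hb, map_mul]
  · obtain ⟨e, rfl⟩ : ∃ e, d = e + 1 := ⟨d - 1, by omega⟩
    refine ((Extends.lin hp a b (hs (hB.2 _ h1 h2)) (hs (hA.2 _ h1 h2))).bind
      fun L₁ hs₁ hp₁ ht₁ => Extends.sum_mul hp₁ ht₁ (Finset.range e)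
        (fun i => PowerSeries.coeff (i + 1) A) (fun i => PowerSeries.coeff (e - i) B)
        (fun i hi => hs₁ (hs (hA.2 _ (by omega) (by have := Finset.mem_range.1 hi; omega))))
        (fun i hi => hs₁ (hs (hB.2 _ (by have := Finset.mem_range.1 hi; omega)
          (by omega))))).mono ?_ fun L₂ _ h₂ => ?_
    · rw [Finset.card_range]
      omega
    · convert h₂ using 1
      rw [PowerSeries.coeff_mul, Finset.Nat.sum_antidiagonal_eq_sum_range_succ
        (fun i j => PowerSeries.coeff i A * PowerSeries.coeff j B), Finset.sum_range_succ,
        Finset.sum_range_succ', ha, Nat.sub_self, hb, Nat.sub_zero]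
      simp only [Nat.add_sub_add_right]
      ring

theorem list_prod {ι : Type} (hL : IsProgram L) (h0 : (0 : MvPolynomial σ ℝ) ∈ L)
    (A : ι → PowerSeries (MvPolynomial σ ℝ)) (l : List ι) (hA : ∀ i ∈ l, Holds n (A i) L) :
    Extends L (l.length * (n * (1 + n * 2))) (Holds n (l.map A).prod) := by
  induction l with
  | nil =>
    have h := const (n := n) h0 1
    rw [map_one, map_one] at h
    simpa using Extends.refl hL h
  | cons i l ih =>
    rw [List.length_cons, add_mul, one_mul, List.map_cons, List.prod_cons]
    exact (ih fun j hj => hA j (List.mem_cons_of_mem _ hj)).bind fun L₁ hs₁ hp₁ ht₁ =>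
      mul hp₁ ((hA i List.mem_cons_self).mono hs₁) ht₁

theorem list_sum {ι : Type} (hL : IsProgram L) (h0 : (0 : MvPolynomial σ ℝ) ∈ L) (a : ι → ℝ)
    (A : ι → PowerSeries (MvPolynomial σ ℝ)) (l : List ι) (hA : ∀ i ∈ l, Holds n (A i) L) :
    Extends L (l.length * n) (Holds n (l.map fun i => PowerSeries.C (C (a i)) * A i).sum) := by
  induction l with
  | nil =>
    have h := const (n := n) h0 0
    rw [map_zero, map_zero] at h
    simpa using Extends.refl hL h
  | cons i l ih =>
    rw [List.length_cons, add_mul, one_mul, List.map_cons, List.sum_cons]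
    exact (ih fun j hj => hA j (List.mem_cons_of_mem _ hj)).bind fun L₁ hs₁ hp₁ ht₁ =>
      smul_add hp₁ _ ((hA i List.mem_cons_self).mono hs₁) ht₁

end Holds

/-! ### Evaluating a circuit on power series -/

section Substitution

variable {σ τ : Type} {n : ℕ}

/-- Substitution of power series for the variables. -/
noncomputable def seriesSubst (z : τ → PowerSeries (MvPolynomial σ ℝ)) :
    MvPolynomial τ ℝ →+* PowerSeries (MvPolynomial σ ℝ) :=
  eval₂Hom ((PowerSeries.C (R := MvPolynomial σ ℝ)).comp C) z

theorem Holds.gate {V : Type} {L : List (MvPolynomial σ ℝ)} (hL : IsProgram L)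
    (h0 : (0 : MvPolynomial σ ℝ) ∈ L) (z : τ → PowerSeries (MvPolynomial σ ℝ))
    (hz : ∀ i, Holds n (z i) L) (f : V → MvPolynomial τ ℝ) (g : Gate τ V)
    (hf : ∀ u ∈ g.children, Holds n (seriesSubst z (f u)) L) :
    Extends L (g.children.length * (n * (1 + n * 2))) (Holds n (seriesSubst z (g.value f))) := by
  cases g with
  | var x =>
    simpa [Gate.value, Gate.children, seriesSubst] using Extends.refl hL (hz x)
  | const c =>
    simpa [Gate.value, Gate.children, seriesSubst] using
      Extends.refl hL (Holds.const (n := n) h0 c)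
  | add es =>
    have h := Holds.list_sum hL h0 Prod.fst (fun e => seriesSubst z (f e.2)) es
      fun e he => hf e.2 (List.mem_map_of_mem he)
    refine h.mono ?_ fun L' _ h' => ?_
    · simp only [Gate.children, List.length_map]
      exact Nat.mul_le_mul_left _ (Nat.le_mul_of_pos_right _ (by omega))
    · convert h' using 1
      rw [Gate.value, map_list_sum, List.map_map]
      congr 2
      funext e
      simp [seriesSubst]
  | mul es =>
    have h := Holds.list_prod hL h0 (fun e => seriesSubst z (f e)) es hf
    refine h.mono le_rfl fun L' _ h' => ?_
    convert h' using 1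
    rw [Gate.value, map_list_prod, List.map_map]
    rfl

theorem Holds.circuit {L : List (MvPolynomial σ ℝ)} (hL : IsProgram L)
    (h0 : (0 : MvPolynomial σ ℝ) ∈ L) (z : τ → PowerSeries (MvPolynomial σ ℝ))
    (hz : ∀ i, Holds n (z i) L) (D : ArithCircuit τ) :
    Extends L (D.size * (n * (1 + n * 2))) (Holds n (seriesSubst z D.poly)) := by
  classical
  have : IsWellFounded D.Node D.Edge := ⟨D.wf⟩
  have key : ∀ s : Finset D.Node, (∀ v ∈ s, ∀ u, D.Edge u v → u ∈ s) →
      Extends L ((∑ v ∈ s, (D.gate v).children.length) * (n * (1 + n * 2)))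
        fun L' => ∀ v ∈ s, Holds n (seriesSubst z (D.nodePoly v)) L' := by
    intro s
    -- Adding nodes by increasing rank keeps the set closed under children: a node of maximal rank
    -- is a child of none of the others.
    induction s using Finset.induction_on_max_value (IsWellFounded.rank D.Edge) with
    | empty =>
      intro _
      simpa using Extends.refl (T := fun _ => True) hL trivial
    | insert a s ha hmax ih =>
      intro hs
      have hs' : ∀ v ∈ s, ∀ u, D.Edge u v → u ∈ s := by
        intro v hv u huv
        rcases Finset.mem_insert.1 (hs v (Finset.mem_insert_of_mem hv) u huv) with rfl | h
        · exact absurd (IsWellFounded.rank_lt_of_rel (r := D.Edge) huv) (not_lt.2 (hmax v hv))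
        · exact h
      rw [Finset.sum_insert ha, add_comm, add_mul]
      refine (ih hs').bind fun L₁ hs₁ hp₁ ht₁ => ?_
      refine (Holds.gate hp₁ (hs₁ h0) z (fun i => (hz i).mono hs₁) D.nodePoly (D.gate a)
        fun u hu => ?_).mono le_rfl fun L₂ hs₂ ht₂ v hv => ?_
      · rcases Finset.mem_insert.1 (hs a (Finset.mem_insert_self _ _) u hu) with rfl | h
        · exact absurd (IsWellFounded.rank_lt_of_rel (r := D.Edge) hu) (lt_irrefl _)
        · exact ht₁ u h
      · rcases Finset.mem_insert.1 hv with rfl | hv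
        · rwa [D.nodePoly_eq_value]
        · exact (ht₁ v hv).mono hs₂
  refine (key Finset.univ fun _ _ _ _ => Finset.mem_univ _).mono ?_ fun L' _ h =>
    h _ (Finset.mem_univ _)
  exact Nat.mul_le_mul_right _ (Nat.le_add_left _ _)

end Substitution

/-! ### The substitution for binary variables -/

section Binary

variable {n : ℕ}

/-- The power series `T x_i / (1 + T x̄_i)` in `T`. -/
noncomputable def ratioSeries (i : Fin n) : PowerSeries (MvPolynomial (Fin n × Fin 2) ℝ) :=
  PowerSeries.mk fun d => if d = 0 then 0 else X (i, 1) * (-X (i, 0)) ^ (d - 1)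

/-- The power series `1 + T x̄_i` in `T`. -/
noncomputable def denomSeries (i : Fin n) : PowerSeries (MvPolynomial (Fin n × Fin 2) ℝ) :=
  1 + PowerSeries.C (X (i, 0)) * PowerSeries.X

theorem denomSeries_mul_ratioSeries (i : Fin n) :
    denomSeries i * ratioSeries i = PowerSeries.C (X (i, 1)) * PowerSeries.X := by
  ext1 d
  rw [denomSeries, add_mul, one_mul, map_add, mul_assoc, PowerSeries.coeff_C_mul,
    PowerSeries.coeff_C_mul, PowerSeries.coeff_X]
  rcases d with _ | _ | d
  · simp [ratioSeries]
  · rw [PowerSeries.coeff_succ_X_mul]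
    simp [ratioSeries]
  · rw [PowerSeries.coeff_succ_X_mul]
    simp [ratioSeries, pow_succ]
    ring

/-- The set-multilinear polynomial whose coefficients are the probabilities of `p`. -/
noncomputable def eventPoly {d : ℕ} (p : PMF (Fin n → Fin d)) :
    MvPolynomial (Fin n × Fin d) ℝ :=
  ∑ a, C (p a).toReal * ∏ i, X (i, a i)

theorem eval_eventPoly {d : ℕ} (p : PMF (Fin n → Fin d)) (a : Fin n → Fin d) :
    eval (eventPoint a) (eventPoly p) = (p a).toReal := by
  rw [eventPoly, map_sum, Finset.sum_eq_single a]
  · simp [eventPoint]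
  · intro b _ hb
    obtain ⟨i, hi⟩ := Function.ne_iff.1 hb
    rw [map_mul, map_prod, Finset.prod_eq_zero (Finset.mem_univ i), mul_zero]
    simp [eventPoint, hi]
  · simp

theorem isSetMultilinear_eventPoly {d : ℕ} (p : PMF (Fin n → Fin d)) :
    IsSetMultilinear (variableParts n d) (eventPoly p) := by
  classical
  intro m hm i
  have hmono : ∀ a : Fin n → Fin d, C (p a).toReal * ∏ i, X (i, a i) =
      monomial (∑ i, Finsupp.single (i, a i) 1) (p a).toReal := by
    intro a
    rw [← mul_one (p a).toReal, ← C_mul_monomial, mul_one, monomial_sum_one]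
    rfl
  obtain ⟨a, -, ha⟩ := Finset.mem_biUnion.1 (support_sum hm)
  rw [hmono] at ha
  have hma := Finset.mem_singleton.1 (support_monomial_subset ha)
  have happ : ∀ y : Fin n × Fin d, m y = if y.2 = a y.1 then 1 else 0 := by
    rintro ⟨j, k⟩
    rw [hma, Finsupp.finsetSum_apply, Finset.sum_eq_single j]
    · simp [Finsupp.single_apply, eq_comm]
    · intro b _ hb
      simp [hb]
    · simp
  refine ⟨(i, a i), rfl, by simp [happ], ?_⟩
  rintro ⟨j, k⟩ rfl hne
  rw [happ, if_neg]
  intro h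
  exact hne (Prod.ext rfl h)

theorem coeff_seriesSubst_genPoly (p : PMF (Fin n → Fin 2)) :
    PowerSeries.coeff n ((∏ i, denomSeries i) * seriesSubst ratioSeries (genPoly p)) =
      eventPoly p := by
  classical
  have hfac : ∀ a : Fin n → Fin 2,
      (∏ i, denomSeries i) * ∏ i, ratioSeries i ^ (a i : ℕ) =
        ∏ i, ((if a i = 0 then 1 else 0) + PowerSeries.C (X (i, a i)) * PowerSeries.X) := by
    intro a
    rw [← Finset.prod_mul_distrib]
    refine Finset.prod_congr rfl fun i _ => ?_
    rcases Fin.exists_fin_two.1 ⟨a i, rfl⟩ with h | h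
    · rw [h]; simp [denomSeries]
    · rw [h]; simp [denomSeries_mul_ratioSeries]
  -- The top coefficient of a product of linear polynomials is the product of their leading
  -- coefficients. Genuine polynomials are used here because the argument is a degree bound.
  have hcoeff : ∀ (s : Finset (Fin n)) (u x : Fin n → MvPolynomial (Fin n × Fin 2) ℝ),
      (∏ i ∈ s, (Polynomial.C (u i) + Polynomial.C (x i) * Polynomial.X)).coeff s.card =
        ∏ i ∈ s, x i := by
    intro s u x
    have h := Polynomial.coeff_prod_of_natDegree_le
      (s := s) (fun i => Polynomial.C (u i) + Polynomial.C (x i) * Polynomial.X) 1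
      (fun i _ => by compute_degree)
    rw [mul_one] at h
    rw [h]
    simp
  rw [genPoly, map_sum, Finset.mul_sum, map_sum, eventPoly]
  refine Finset.sum_congr rfl fun a _ => ?_
  have hsub : seriesSubst ratioSeries (C (p a).toReal * ∏ i, X i ^ (a i : ℕ)) =
      PowerSeries.C (C (p a).toReal) * ∏ i, ratioSeries i ^ (a i : ℕ) := by
    simp [seriesSubst]
  rw [hsub, mul_left_comm, hfac, PowerSeries.coeff_C_mul]
  congr 1
  have h := hcoeff Finset.univ (fun i => if a i = 0 then 1 else 0) (fun i => X (i, a i))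
  rw [Finset.card_univ, Fintype.card_fin] at h
  rw [← h, ← Polynomial.coeff_coe]
  congr 1
  rw [← Polynomial.coeToPowerSeries.ringHom_apply, map_prod]
  refine Finset.prod_congr rfl fun i _ => ?_
  dsimp only
  split_ifs with h0 <;> simp

/-- The coefficients of `denomSeries` and `ratioSeries` are computed from the variables. -/
theorem extends_series (hn : 1 ≤ n) :
    Extends ([] : List (MvPolynomial (Fin n × Fin 2) ℝ)) (2 + n * (3 + n)) fun L =>
      0 ∈ L ∧ ∀ i : Fin n, Holds n (denomSeries i) L ∧ Holds n (ratioSeries i) L := by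
  refine Extends.bind (T := (0 ∈ ·)) ?_ fun L _ hL h0 => ?_
  -- Zero is obtained as `0 * x + 0 * x`, which requires some variable, hence `1 ≤ n`.
  · refine ((Extends.var IsProgram.nil ((⟨0, hn⟩, 0) : Fin n × Fin 2)).bind (d := 1)
      fun L _ hL h => Extends.lin hL 0 0 h h).mono le_rfl fun L _ h => ?_
    simpa using h
  -- For each `i`: two variables, one negation, and `n` multiplications by `-x̄_i`.
  · have h := Extends.forall_mem hL (Finset.univ : Finset (Fin n)) (3 + n)
      (fun i L' => Holds n (denomSeries i) L' ∧ Holds n (ratioSeries i) L')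
      (fun i _ L₁ L₂ hs h => ⟨h.1.mono hs, h.2.mono hs⟩) fun i _ L₁ hs₁ hp₁ => ?_
    · rw [Finset.card_univ, Fintype.card_fin] at h
      exact h.mono le_rfl fun L' hs h' => ⟨hs h0, fun i => h' i (Finset.mem_univ _)⟩
    · have hpow : ∀ (d : ℕ) (L₂ : List (MvPolynomial (Fin n × Fin 2) ℝ)), IsProgram L₂ →
          X (i, 1) ∈ L₂ → -X (i, 0) ∈ L₂ →
          Extends L₂ d fun L' => ∀ e ≤ d, X (i, 1) * (-X (i, 0)) ^ e ∈ L' := by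
        intro d L₂ hp₂ hx hy
        induction d with
        | zero =>
          refine (Extends.refl (T := (X (i, 1) ∈ ·)) hp₂ hx).mono le_rfl fun L' _ h e he => ?_
          obtain rfl : e = 0 := by omega
          simpa using h
        | succ d ih =>
          refine ih.bind fun L₃ hs₃ hp₃ h₃ => ?_
          refine (Extends.mul hp₃ (h₃ d le_rfl) (hs₃ hy)).mono le_rfl fun L₄ hs₄ h₄ e he => ?_
          rcases Nat.lt_or_ge d e with hlt | hle
          · obtain rfl : e = d + 1 := by omega
            rwa [pow_succ, ← mul_assoc]
          · exact hs₄ (h₃ e hle)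
      refine ((((Extends.var hp₁ ((i, 1) : Fin n × Fin 2)).bind (d := 1)
        (U := fun L' => X (i, 1) ∈ L' ∧ X (i, 0) ∈ L') fun L₂ _ hp₂ h₂ =>
          (Extends.var hp₂ ((i, 0) : Fin n × Fin 2)).mono le_rfl fun _ hs h => ⟨hs h₂, h⟩).bind
        (d := 1) (U := fun L' => X (i, 1) ∈ L' ∧ X (i, 0) ∈ L' ∧ -X (i, 0) ∈ L')
        fun L₂ _ hp₂ h₂ => (Extends.lin hp₂ (-1) 0 h₂.2 h₂.2).mono le_rfl fun _ hs h =>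
          ⟨hs h₂.1, hs h₂.2, by simpa using h⟩).bind (d := n)
        (U := fun L' => X (i, 0) ∈ L' ∧ ∀ e ≤ n, X (i, 1) * (-X (i, 0)) ^ e ∈ L')
        fun L₂ _ hp₂ h₂ => (hpow n L₂ hp₂ h₂.1 h₂.2.2).mono le_rfl fun _ hs h =>
          ⟨hs h₂.2.1, h⟩).mono le_rfl fun L₂ hs₂ h₂ => ⟨⟨⟨1, ?_⟩, fun d h1 _ => ?_⟩,
            ⟨⟨0, ?_⟩, fun d h1 h2 => ?_⟩⟩
      · simp [denomSeries]
      · rw [denomSeries, map_add, PowerSeries.coeff_C_mul, PowerSeries.coeff_one,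
          if_neg (by omega), zero_add, PowerSeries.coeff_X]
        split_ifs
        · simpa using h₂.1
        · simpa using hs₂ (hs₁ h0)
      · simp [ratioSeries]
      · rw [ratioSeries, PowerSeries.coeff_mk, if_neg (by omega)]
        exact h₂.2 _ (by omega)

theorem extends_eventPoly (hn : 1 ≤ n) (p : PMF (Fin n → Fin 2)) (D : ArithCircuit (Fin n))
    (hD : IsPGC D p) :
    Extends [] (2 + n * (3 + n) + D.size * (n * (1 + n * 2)) + n * (n * (1 + n * 2))
      + n * (1 + n * 2)) (eventPoly p ∈ ·) := by
  refine ((((extends_series hn).bind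
    (U := fun L => 0 ∈ L ∧ (∀ i : Fin n, Holds n (denomSeries i) L) ∧
      Holds n (seriesSubst ratioSeries D.poly) L) fun L _ hL h =>
    (Holds.circuit hL h.1 ratioSeries (fun i => (h.2 i).2) D).mono le_rfl fun L' hs h' =>
      ⟨hs h.1, fun i => (h.2 i).1.mono hs, h'⟩).bind
    (U := fun L => Holds n (∏ i : Fin n, denomSeries i) L ∧
      Holds n (seriesSubst ratioSeries D.poly) L) fun L _ hL h =>
    (Holds.list_prod hL h.1 denomSeries (List.finRange n) fun i _ => h.2.1 i).mono
      (by rw [List.length_finRange]) fun L' hs h' => ⟨?_, h.2.2.mono hs⟩).bind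
    fun L _ hL h => Holds.mul hL h.1 h.2).mono le_rfl fun L _ h => ?_
  · rwa [← List.ofFn_eq_map, List.prod_ofFn] at h'
  -- Degree `n` is among the stored ones because `1 ≤ n`.
  · have hc := h.2 n hn le_rfl
    rwa [hD, coeff_seriesSubst_genPoly] at hc

end Binary

/-! ### The simulation theorem -/

theorem mainTheorem1 :
    ∃ c k : ℕ, ∀ (n : ℕ), 1 ≤ n → ∀ (p : PMF (Fin n → Fin 2)) (C : ArithCircuit (Fin n)),
      IsPGC C p →
      ∃ D : ArithCircuit (Fin n × Fin 2),
        IsNonmonotonePC D ∧ ComputesPMF D p ∧ IsSetMultilinear (variableParts n 2) D.poly ∧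
        D.size ≤ c * (C.size + n) ^ k := by
  refine ⟨36, 3, fun n hn p C hC => ?_⟩
  obtain ⟨L, -, hL, hlen, hmem⟩ := extends_eventPoly hn p C hC
  obtain ⟨D, hconst, hpoly, hsize⟩ := hL.exists_circuit hmem
  refine ⟨D, hconst, fun a => ?_, ?_, hsize.trans ?_⟩
  · rw [hpoly, eval_eventPoly]
  · rw [hpoly]
    exact isSetMultilinear_eventPoly p
  · rw [List.length_nil, zero_add] at hlen
    -- For `n ≥ 1` the terms without the circuit size are at most `6 n ^ 3`, `3 n ^ 3` and `3 n ^
    -- 3`, whence 12; the remaining one is at most `3 s n ^ 2`, where `s` is the circuit size.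
    have h1 : L.length ≤ 12 * (C.size + n) ^ 3 := by
      refine hlen.trans ?_
      set s := C.size
      obtain ⟨m, rfl⟩ : ∃ m, n = m + 1 := ⟨n - 1, by omega⟩
      ring_nf
      nlinarith [Nat.zero_le (s * m), Nat.zero_le (s * m ^ 2), Nat.zero_le (s ^ 2 * m),
        Nat.zero_le (s ^ 3), Nat.zero_le (s ^ 2), Nat.zero_le (m ^ 3), Nat.zero_le (m ^ 2)]
    calc 3 * L.length ≤ 3 * (12 * (C.size + n) ^ 3) := Nat.mul_le_mul_left _ h1
      _ = 36 * (C.size + n) ^ 3 := by ring
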